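/- Let $n\ge 0$ and let $A=(a_1,\dots,a_n)$ range over sequences of $n$ distinct real numbers. Let $a_i^+$ (resp. $a_i^-$) be the length of the longest increasing (resp. decreasing) subsequence of $A$ that ends at $a_i$. The Erdős–Szekeres tableau (EST) of $A$ is the sequence of lattice points $T(A)=\big((a_i^+,a_i^-)\big)_{1\le i\le n}$. A sequence $T=(t_i)_{1\le i\le n}$ of lattice points is called an EST if $T=T(A)$ for some such $A$. The order poset of an EST $T$ is $P(T)=([n],<_{P(T)})$, where $i<_{P(T)}j$ if and only if $a_i<a_j$ for every sequence $A=(a_1,\dots,a_n)$ of distinct real numbers with $T(A)=T$. Write $t_i=(x_i,y_i)$ and $T_j=\{t_1,\dots,t_j\}$, and for a lattice point $(x,y)$ let $\mathrm{Col}(x,y)=\{(x,y') : y'>y\}$ and $\mathrm{Row}(x,y)=\{(x',y) : x'>x\}$. For $i<j$ we say that - $t_i$ hooks $t_j$ if there is an integer $x$ with $x_i\le x\le x_j$ and $\mathrm{Col}(x,y_i)\cap T_j=\emptyset$; - $t_i$ slices $t_j$ if there is an integer $y$ with $y_i\le y\le y_j$ and $\mathrm{Row}(x_i,y)\cap T_j=\emptyset$.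 Let $R_T$ be the relation on $[n]$ in which $i\mathrel{R_T}j$ if and only if $t_i$ hooks $t_j$ or $t_j$ slices $t_i$. **Theorem.** For every EST $T$, the strict order $<_{P(T)}$ is equal to the transitive closure of $R_T$. -/

import Mathlib

/-- The length of the longest increasing subsequence of `A` that ends at position `i`. -/
noncomputable def incLen {n : ℕ} (A : Fin n → ℝ) (i : Fin n) : ℕ :=
  open Classical in
  (Finset.univ.filter fun s : Finset (Fin n) =>
    i ∈ s ∧ (∀ k ∈ s, k ≤ i) ∧ StrictMonoOn A (s : Set (Fin n))).sup Finset.card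

/-- The length of the longest decreasing subsequence of `A` that ends at position `i`. -/
noncomputable def decLen {n : ℕ} (A : Fin n → ℝ) (i : Fin n) : ℕ :=
  open Classical in
  (Finset.univ.filter fun s : Finset (Fin n) =>
    i ∈ s ∧ (∀ k ∈ s, k ≤ i) ∧ StrictAntiOn A (s : Set (Fin n))).sup Finset.card

/-- The Erdős–Szekeres tableau of a number sequence: the sequence of points
`(length of longest increasing, length of longest decreasing)` subsequence ending at each term. -/
noncomputable def tableau {n : ℕ} (A : Fin n → ℝ) : Fin n → ℕ × ℕ :=
  fun i => (incLen A i, decLen A i)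

/-- `Generates A T`: the sequence `A` has distinct terms and its tableau is `T`;
that is, `A` belongs to the class `[T]`. -/
def Generates {n : ℕ} (A : Fin n → ℝ) (T : Fin n → ℕ × ℕ) : Prop :=
  Function.Injective A ∧ tableau A = T

/-- `T` is the Erdős–Szekeres tableau of some sequence of distinct numbers. -/
def IsEST {n : ℕ} (T : Fin n → ℕ × ℕ) : Prop :=
  ∃ A : Fin n → ℝ, Generates A T

/-- The strict order of the order poset of `T`: `i` lies below `j` when the `i`-th term is smaller
than the `j`-th term in every sequence that generates `T`. -/
def OrderPosetLT {n : ℕ} (T : Fin n → ℕ × ℕ) (i j : Fin n) : Prop :=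
  ∀ A : Fin n → ℝ, Generates A T → A i < A j

/-- For a tableau this relation is a strict partial order. -/
theorem IsEST.isStrictOrder {n : ℕ} {T : Fin n → ℕ × ℕ} (hT : IsEST T) :
    IsStrictOrder (Fin n) (OrderPosetLT T) where
  irrefl i h := by
    obtain ⟨A, hA⟩ := hT
    exact lt_irrefl _ (h A hA)
  trans _ _ _ h₁ h₂ A hA := (h₁ A hA).trans (h₂ A hA)

/-- The column above a point. -/
def pointCol (p : ℕ × ℕ) : Set (ℕ × ℕ) := {q | q.1 = p.1 ∧ p.2 < q.2}

/-- The row beyond a point. -/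
def pointRow (p : ℕ × ℕ) : Set (ℕ × ℕ) := {q | q.2 = p.2 ∧ p.1 < q.1}

/-- The set of points of `T` with index at most `j` (including the point of index `j`). -/
def initialPoints {n : ℕ} (T : Fin n → ℕ × ℕ) (j : Fin n) : Set (ℕ × ℕ) := T '' Set.Iic j

/-- The `i`-th point of `T` hooks the `j`-th point. -/
def Hooks {n : ℕ} (T : Fin n → ℕ × ℕ) (i j : Fin n) : Prop :=
  i < j ∧ ∃ x : ℕ, (T i).1 ≤ x ∧ x ≤ (T j).1 ∧
    pointCol (x, (T i).2) ∩ initialPoints T j = ∅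

/-- The `i`-th point of `T` slices the `j`-th point. -/
def Slices {n : ℕ} (T : Fin n → ℕ × ℕ) (i j : Fin n) : Prop :=
  i < j ∧ ∃ y : ℕ, (T i).2 ≤ y ∧ y ≤ (T j).2 ∧
    pointRow ((T i).1, y) ∩ initialPoints T j = ∅

/-- The order relations read off from hooks and slices: `i` is placed below `j` when the `i`-th
point hooks the `j`-th point, or when the `j`-th point slices the `i`-th point. -/
def HookSliceRel {n : ℕ} (T : Fin n → ℕ × ℕ) (i j : Fin n) : Prop :=
  Hooks T i j ∨ Slices T j i

/-! ### Longest increasing subsequences. -/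

section IncLen

variable {n : ℕ} {A : Fin n → ℝ} {i j : Fin n}

/-! Hooks and slices are forced in every generator (`lt_of_hookSliceRel`). Conversely they determine
the tableau: any injective sequence respecting them generates `T` (`of_hookSliceRel`). So if `j` is
not reachable from `i`, lifting everything reachable from `i` far enough gives a generator with the
`j`-th term below the `i`-th. -/

theorem card_le_incLen {s : Finset (Fin n)} (hj : j ∈ s) (hle : ∀ k ∈ s, k ≤ j)
    (hs : StrictMonoOn A (s : Set (Fin n))) : s.card ≤ incLen A j := by
  classical
  unfold incLen
  exact Finset.le_sup (f := Finset.card) (by simpa using ⟨hj, hle, hs⟩)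

theorem exists_card_eq_incLen (A : Fin n → ℝ) (j : Fin n) : ∃ s : Finset (Fin n),
    j ∈ s ∧ (∀ k ∈ s, k ≤ j) ∧ StrictMonoOn A (s : Set (Fin n)) ∧ s.card = incLen A j := by
  classical
  have hne : (Finset.univ.filter fun s : Finset (Fin n) =>
      j ∈ s ∧ (∀ k ∈ s, k ≤ j) ∧ StrictMonoOn A (s : Set (Fin n))).Nonempty :=
    ⟨{j}, by simp⟩
  obtain ⟨s, hs, hcard⟩ := Finset.exists_mem_eq_sup _ hne Finset.card
  simp only [Finset.mem_filter, Finset.mem_univ, true_and] at hs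
  refine ⟨s, hs.1, hs.2.1, hs.2.2, ?_⟩
  unfold incLen
  convert hcard.symm

theorem strictMonoOn_insert {s : Finset (Fin n)} (hi : i ∈ s) (hle : ∀ k ∈ s, k ≤ i)
    (hs : StrictMonoOn A (s : Set (Fin n))) (hij : i < j) (hA : A i < A j) :
    StrictMonoOn A ((insert j s : Finset (Fin n)) : Set (Fin n)) := by
  intro a ha b hb hab
  simp only [Finset.coe_insert, Set.mem_insert_iff, Finset.mem_coe] at ha hb
  rcases ha with rfl | ha <;> rcases hb with rfl | hb
  · exact absurd hab (lt_irrefl _)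
  · exact absurd (hab.trans_le (hle _ hb)) hij.not_gt
  · exact (hs.monotoneOn ha hi (hle a ha)).trans_lt hA
  · exact hs ha hb hab

theorem card_add_one_le_incLen {s : Finset (Fin n)} (hi : i ∈ s) (hle : ∀ k ∈ s, k ≤ i)
    (hs : StrictMonoOn A (s : Set (Fin n))) (hij : i < j) (hA : A i < A j) :
    s.card + 1 ≤ incLen A j := by
  rw [← Finset.card_insert_of_notMem fun h => hij.not_ge (hle j h)]
  refine card_le_incLen (Finset.mem_insert_self _ _) ?_ (strictMonoOn_insert hi hle hs hij hA)
  intro k hk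
  rcases Finset.mem_insert.1 hk with rfl | hk
  · exact le_rfl
  · exact (hle k hk).trans hij.le

theorem incLen_lt (hij : i < j) (hA : A i < A j) : incLen A i < incLen A j := by
  obtain ⟨s, hi, hle, hs, hcard⟩ := exists_card_eq_incLen A i
  rw [← hcard]
  exact card_add_one_le_incLen hi hle hs hij hA

theorem one_le_incLen (A : Fin n → ℝ) (j : Fin n) : 1 ≤ incLen A j := by
  simpa using card_le_incLen (A := A) (Finset.mem_singleton_self j) (by simp) (by simp)

theorem exists_incLen_add_one (h : 2 ≤ incLen A j) :
    ∃ i < j, A i < A j ∧ incLen A i + 1 = incLen A j := by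
  obtain ⟨s, hj, hle, hs, hcard⟩ := exists_card_eq_incLen A j
  have hcard' : (s.erase j).card + 1 = incLen A j := by
    rw [Finset.card_erase_add_one hj, hcard]
  have hne : (s.erase j).Nonempty := Finset.card_pos.1 (by omega)
  have hmem := (s.erase j).max'_mem hne
  set i := (s.erase j).max' hne
  obtain ⟨hij', his⟩ := Finset.mem_erase.1 hmem
  have hij : i < j := lt_of_le_of_ne (hle i his) hij'
  have hA : A i < A j := hs his hj hij
  have hge := card_le_incLen hmem (fun k hk => Finset.le_max' _ k hk)
    (hs.mono (Finset.coe_subset.2 (Finset.erase_subset j s)))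
  exact ⟨i, hij, hA, by have := incLen_lt hij hA; omega⟩

/-- Along an increasing subsequence `f` is injective into `[1, f j]`, which bounds its length;
chains of predecessors attain the bound. -/
theorem incLen_eq_of_forall {f : Fin n → ℕ} (hpos : ∀ j, 1 ≤ f j)
    (hlt : ∀ i j, i < j → A i < A j → f i < f j)
    (hex : ∀ j, 2 ≤ f j → ∃ i < j, A i < A j ∧ f i + 1 = f j) (j : Fin n) :
    incLen A j = f j := by
  apply le_antisymm
  · obtain ⟨s, hj, hle, hs, hcard⟩ := exists_card_eq_incLen A j
    have hf : StrictMonoOn f (s : Set (Fin n)) := fun a ha b hb hab =>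
      hlt a b hab (hs ha hb hab)
    calc incLen A j = s.card := hcard.symm
      _ ≤ (Finset.Icc 1 (f j)).card :=
        Finset.card_le_card_of_injOn f
          (fun k hk => Finset.mem_coe.2 <| Finset.mem_Icc.2
            ⟨hpos k, hf.monotoneOn hk hj (hle k hk)⟩) hf.injOn
      _ = f j := by simp
  · induction j using WellFoundedLT.induction with
    | ind j ih =>
      rcases le_or_gt 2 (f j) with h | h
      · obtain ⟨i, hij, hA, hf⟩ := hex j h
        have := ih i hij
        have := incLen_lt hij hA
        omega
      · have := one_le_incLen A j
        omega

theorem exists_incLen_eq (j : Fin n) {x : ℕ} (hx : 1 ≤ x) (hxj : x ≤ incLen A j) :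
    ∃ k ≤ j, A k ≤ A j ∧ incLen A k = x := by
  induction j using WellFoundedLT.induction with
  | ind j ih =>
    rcases hxj.eq_or_lt with h | h
    · exact ⟨j, le_rfl, le_rfl, h.symm⟩
    · obtain ⟨i, hij, hA, hi⟩ := exists_incLen_add_one (A := A) (j := j) (by omega)
      obtain ⟨k, hk, hAk, hxk⟩ := ih i hij (by omega)
      exact ⟨k, hk.trans hij.le, hAk.trans hA.le, hxk⟩

theorem incLen_neg (A : Fin n → ℝ) : incLen (-A) = decLen A := by
  ext j
  simp only [incLen, decLen, StrictMonoOn, StrictAntiOn, Pi.neg_apply, neg_lt_neg_iff]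
  congr!

theorem decLen_neg (A : Fin n → ℝ) : decLen (-A) = incLen A := by
  rw [← incLen_neg, neg_neg]

end IncLen

/-! ### Hooks, slices and generators. -/

section Tableau

variable {n : ℕ} {A B : Fin n → ℝ} {T : Fin n → ℕ × ℕ} {i j : Fin n}

/-- Negation swaps coordinates, so only the increasing half of each argument is needed. -/
theorem Generates.neg_swap (h : Generates A T) : Generates (-A) (Prod.swap ∘ T) := by
  refine ⟨neg_injective.comp h.1, ?_⟩
  rw [← h.2]
  funext k
  simp [tableau, incLen_neg, decLen_neg]

theorem hooks_swap : Hooks (Prod.swap ∘ T) i j ↔ Slices T i j := by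
  simp only [Hooks, Slices, pointCol, pointRow, initialPoints, Set.eq_empty_iff_forall_notMem,
    Set.mem_inter_iff, Set.mem_image, Function.comp_apply, Prod.fst_swap, Prod.snd_swap,
    Prod.forall, Set.mem_ofPred_eq, not_and, not_exists, Prod.swap_eq_iff_eq_swap, Prod.swap_prod_mk]
  refine and_congr_right fun _ => exists_congr fun y => and_congr_right fun _ =>
    and_congr_right fun _ => forall_comm.trans ?_
  simp only [and_imp]

theorem slices_swap : Slices (Prod.swap ∘ T) i j ↔ Hooks T i j := by
  rw [← hooks_swap, ← Function.comp_assoc, Prod.swap_swap_eq, Function.id_comp]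

theorem hookSliceRel_swap : HookSliceRel (Prod.swap ∘ T) i j ↔ HookSliceRel T j i := by
  rw [HookSliceRel, HookSliceRel, hooks_swap, slices_swap, or_comm]

namespace Generates

theorem fst_eq (h : Generates A T) (k : Fin n) : (T k).1 = incLen A k := by
  rw [← h.2]; rfl

theorem snd_eq (h : Generates A T) (k : Fin n) : (T k).2 = decLen A k := by
  rw [← h.2]; rfl

theorem fst_lt (h : Generates A T) (hij : i < j) (hA : A i < A j) : (T i).1 < (T j).1 := by
  rw [h.fst_eq, h.fst_eq]; exact incLen_lt hij hA

theorem snd_lt (h : Generates A T) (hij : i < j) (hA : A j < A i) : (T i).2 < (T j).2 := by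
  rw [h.snd_eq, h.snd_eq, ← incLen_neg]; exact incLen_lt hij (neg_lt_neg hA)

theorem fst_lt_or_snd_lt (h : Generates A T) (hij : i < j) :
    (T i).1 < (T j).1 ∨ (T i).2 < (T j).2 :=
  (lt_or_gt_of_ne (h.1.ne hij.ne)).imp (h.fst_lt hij) (h.snd_lt hij)

/-- If `A j < A i`, an increasing subsequence ending at `j` has a term of first coordinate `x` below
`A i`. It cannot precede `i`, so its point lies in the column assumed empty. -/
theorem lt_of_hooks (h : Generates A T) (hij : Hooks T i j) : A i < A j := by
  obtain ⟨hlt, x, hix, hxj, hempty⟩ := hij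
  by_contra hA
  have hA : A j < A i := lt_of_le_of_ne (not_lt.1 hA) (h.1.ne hlt.ne')
  have hx : 1 ≤ x := (one_le_incLen A i).trans (h.fst_eq i ▸ hix)
  obtain ⟨k, hkj, hAk, hk⟩ := exists_incLen_eq (A := A) j hx (h.fst_eq j ▸ hxj)
  rw [← h.fst_eq] at hk
  have hAki : A k < A i := hAk.trans_lt hA
  rcases lt_trichotomy k i with hki | rfl | hki
  · have := h.fst_lt hki hAki
    omega
  · exact lt_irrefl _ hAki
  · exact Set.notMem_empty (T k)
      (hempty ▸ ⟨⟨hk, h.snd_lt hki hAki⟩, Set.mem_image_of_mem T hkj⟩)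

theorem lt_of_hookSliceRel (h : Generates A T) (hij : HookSliceRel T i j) : A i < A j := by
  rcases hij with hij | hij
  · exact h.lt_of_hooks hij
  · exact neg_lt_neg_iff.1 (h.neg_swap.lt_of_hooks (hooks_swap.2 hij))

theorem slices_of_fst_le (h : Generates A T) (hij : i < j) (hle : (T j).1 ≤ (T i).1) :
    Slices T i j := by
  have hsnd : (T i).2 < (T j).2 := (h.fst_lt_or_snd_lt hij).resolve_left hle.not_gt
  refine ⟨hij, (T j).2, hsnd.le, le_rfl, Set.eq_empty_iff_forall_notMem.2 ?_⟩
  rintro _ ⟨⟨hk₂, hk₁⟩, k, hk, rfl⟩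
  simp only at hk₁ hk₂
  rcases (Set.mem_Iic.1 hk).eq_or_lt with rfl | hkj
  · omega
  · have := h.fst_lt_or_snd_lt hkj
    omega

theorem exists_hooks (h : Generates A T) (hj : 2 ≤ (T j).1) :
    ∃ i < j, Hooks T i j ∧ (T i).1 + 1 = (T j).1 := by
  classical
  obtain ⟨i₀, hi₀, -, hx₀⟩ := exists_incLen_add_one (A := A) (j := j) (h.fst_eq j ▸ hj)
  rw [← h.fst_eq, ← h.fst_eq] at hx₀
  let s := Finset.univ.filter fun i : Fin n => i < j ∧ (T i).1 + 1 = (T j).1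
  have hs : s.Nonempty := ⟨i₀, by simp [s, hi₀, hx₀]⟩
  obtain ⟨hij, hx⟩ : s.max' hs < j ∧ (T (s.max' hs)).1 + 1 = (T j).1 := by
    simpa [s] using s.max'_mem hs
  -- By maximality, a point in the column above the chosen one would have to come earlier, yet
  -- neither coordinate would then increase.
  refine ⟨s.max' hs, hij, ⟨hij, _, le_rfl, by omega, Set.eq_empty_iff_forall_notMem.2 ?_⟩, hx⟩
  rintro _ ⟨⟨hk₁, hk₂⟩, k, hk, rfl⟩
  simp only at hk₁ hk₂
  rcases (Set.mem_Iic.1 hk).eq_or_lt with rfl | hkj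
  · omega
  · have hle : k ≤ s.max' hs := s.le_max' k (by simp [s, hkj]; omega)
    rcases hle.eq_or_lt with hkm | hkm
    · rw [← hkm] at hk₂
      exact lt_irrefl _ hk₂
    · have := h.fst_lt_or_snd_lt hkm
      omega

/-- Slices rule out ascents of `B` on which the first coordinate fails to grow; hooks supply the
predecessors. -/
theorem incLen_eq_fst (h : Generates A T) (hB : ∀ a b, HookSliceRel T a b → B a < B b)
    (j : Fin n) : incLen B j = (T j).1 := by
  refine incLen_eq_of_forall (f := fun k => (T k).1)
    (fun k => h.fst_eq k ▸ one_le_incLen A k) ?_ ?_ j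
  · intro i j hij hlt
    by_contra hle
    exact hlt.not_gt (hB j i (Or.inr (h.slices_of_fst_le hij (not_lt.1 hle))))
  · intro j hj
    obtain ⟨i, hij, hook, hx⟩ := h.exists_hooks hj
    exact ⟨i, hij, hB i j (Or.inl hook), hx⟩

/-- Every injective sequence compatible with the hooks and slices of `T` generates `T`. -/
theorem of_hookSliceRel (h : Generates A T) (hinj : Function.Injective B)
    (hB : ∀ a b, HookSliceRel T a b → B a < B b) : Generates B T := by
  refine ⟨hinj, funext fun k => Prod.ext (h.incLen_eq_fst hB k) ?_⟩
  have := h.neg_swap.incLen_eq_fst (B := -B)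
    (fun a b hab => neg_lt_neg (hB b a (hookSliceRel_swap.1 hab))) k
  rwa [incLen_neg] at this

/-- Raising the terms above `i` by a large constant yields a generator in which every other term
lies below the `i`-th one. -/
theorem exists_lt_of_not_reflTransGen (h : Generates A T)
    (hij : ¬ Relation.ReflTransGen (HookSliceRel T) i j) :
    ∃ B : Fin n → ℝ, Generates B T ∧ B j < B i := by
  classical
  obtain ⟨M, hM⟩ : ∃ M, ∀ a b, A a < A b + M := by
    obtain ⟨u, hu⟩ := (Set.finite_range A).bddAbove
    obtain ⟨l, hl⟩ := (Set.finite_range A).bddBelow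
    refine ⟨u - l + 1, fun a b => ?_⟩
    have := hu (Set.mem_range_self a)
    have := hl (Set.mem_range_self b)
    linarith
  have hM₀ : 0 < M := by have := hM i i; linarith
  let B : Fin n → ℝ := fun k =>
    if Relation.ReflTransGen (HookSliceRel T) i k then A k + M else A k
  refine ⟨B, h.of_hookSliceRel ?_ ?_, ?_⟩
  · intro a b hab
    have hba := hM b a
    have hab' := hM a b
    simp only [B] at hab
    split_ifs at hab
    · exact h.1 (add_right_cancel hab)
    · linarith
    · linarith
    · exact h.1 hab
  -- The lifted set is closed upward under the relation, so lifting reverses no required inequality.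
  · intro a b hab
    have hA := h.lt_of_hookSliceRel hab
    by_cases ha : Relation.ReflTransGen (HookSliceRel T) i a
    · simpa only [B, if_pos ha, if_pos (ha.tail hab), add_lt_add_iff_right] using hA
    · simp only [B, if_neg ha]
      split_ifs <;> linarith
  · simp only [B, if_neg hij, if_pos Relation.ReflTransGen.refl]
    exact hM j i

end Generates

end Tableau

theorem theorem2p3 {n : ℕ} (T : Fin n → ℕ × ℕ) (hT : IsEST T) :
    OrderPosetLT T = Relation.TransGen (HookSliceRel T) := by
  have := hT.isStrictOrder
  obtain ⟨A, hA⟩ := hT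
  funext i j
  refine propext ⟨fun hij => ?_, fun hij B hB => ?_⟩
  · have hne : j ≠ i := fun e => irrefl_of (OrderPosetLT T) i (e ▸ hij)
    by_contra hnot
    have hrefl : ¬ Relation.ReflTransGen (HookSliceRel T) i j := fun hr =>
      (Relation.reflTransGen_iff_eq_or_transGen.1 hr).elim hne hnot
    obtain ⟨B, hB, hlt⟩ := hA.exists_lt_of_not_reflTransGen hrefl
    exact hlt.not_gt (hij B hB)
  · induction hij with
    | single h => exact hB.lt_of_hookSliceRel h
    | tail _ h ih => exact ih.trans (hB.lt_of_hookSliceRel h)
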